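/- Let $a_{uv}\ge 0$ be the adjacency weights of a fixed directed communication graph without self-connections on followers $\mathcal F=\{1,\dots,n\}$ and leaders $\mathcal R=\{n+1,\dots,n+m\}$, where $a_{uv}>0$ means that agent $u$ receives information from agent $v$, and leaders receive no information ($a_{kv}=0$ for $k\in\mathcal R$). For a follower $i$ let $\bar N_i^L\subseteq\mathcal R$ be the set of its influential leaders, i.e. those with a directed path to $i$. Each leader $k$ has dynamics $\dot\omega_k=S_k\omega_k$, $y_k=D_k\omega_k$, with $S_k\in\mathbb R^{q\times q}$, $D_k\in\mathbb R^{Q\times q}$. Each follower $i$ keeps, for every $k\in\bar N_i^L$, estimates $\eta_i^k\in\mathbb R^q$, $S_i^k\in\mathbb R^{q\times q}$, $D_i^k\in\mathbb R^{Q\times q}$ of $\omega_k$, $S_k$, $D_k$, which satisfy, for $t\ge 0$, the adaptive distributed observer $$\dot\eta_i^k=S_i^k\eta_i^k+\beta^\eta\Big(\sum_{j}a_{ij}(\eta_j^k-\eta_i^k)+a_{ik}(\omega_k-\eta_i^k)\Big),$$ $$\dot S_i^k=\beta^S\Big(\sum_{j}a_{ij}(S_j^k-S_i^k)+a_{ik}(S_k-S_i^k)\Big),\qquad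 \dot D_i^k=\beta^D\Big(\sum_{j}a_{ij}(D_j^k-D_i^k)+a_{ik}(D_k-D_i^k)\Big),$$ where $j$ runs over the followers that are neighbours of $i$ and where, if $k\notin\bar N_j^L$, the symbols $\eta_j^k,S_j^k,D_j^k$ in the equations of follower $i$ stand for $\eta_i^k,S_i^k,D_i^k$. Let $\tilde\eta_i,\tilde S_i,\tilde D_i$ be the column stacks over $k\in\bar N_i^L$ of the errors $\eta_i^k-\omega_k$, $S_i^k-S_k$, $D_i^k-D_k$. Then for all initial conditions and every follower $i$: 1. if $\beta^S>0$, then $\tilde S_i(t)\to0$ exponentially as $t\to\infty$; 2. if $\beta^D>0$, then $\tilde D_i(t)\to0$ exponentially as $t\to\infty$; 3. if all leaders' dynamics are marginally stable (every solution of $\dot w=S_kw$ is bounded on $[0,\infty)$), $\beta^\eta>0$ and $\beta^S>0$, then $\tilde\eta_i(t)\to0$ exponentially as $t\to\infty$. Here $x(t)\to0$ exponentially means that there are $C$ and $\alpha>0$ with $\|x(t)\|\le Ce^{-\alpha t}$ for all $t\ge0$. -/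

import Mathlib

open scoped Matrix

/-- A fixed weighted directed communication graph on `n` followers `Sum.inl i` and `m` leaders
`Sum.inr k`, given by its weighted adjacency matrix `a`: the weight `a u v` is positive iff agent `u`
receives information from agent `v`. There are no self-connections, and leaders receive no
information (their rows of the Laplacian vanish). -/
structure CommGraph (n m : ℕ) where
  a : Matrix (Fin n ⊕ Fin m) (Fin n ⊕ Fin m) ℝ
  nonneg : ∀ u v, 0 ≤ a u v
  no_self : ∀ u, a u u = 0
  leader_row : ∀ k v, a (Sum.inr k) v = 0

namespace CommGraph

variable {n m : ℕ} (G : CommGraph n m)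

/-- `(u, v)` is an edge: information flows from `u` to `v`. -/
def Edge (u v : Fin n ⊕ Fin m) : Prop := 0 < G.a v u

/-- There is a directed path from `u` to `v`, i.e. `v` is reachable from `u`. -/
def Reaches (u v : Fin n ⊕ Fin m) : Prop := Relation.TransGen G.Edge u v

open Classical in
/-- The leaders that are neighbours of follower `i`. -/
noncomputable def nbrLeaders (i : Fin n) : Finset (Fin m) :=
  Finset.univ.filter fun k => G.Edge (Sum.inr k) (Sum.inl i)

open Classical in
/-- The followers that are neighbours of follower `i`. -/
noncomputable def nbrFollowers (i : Fin n) : Finset (Fin n) :=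
  Finset.univ.filter fun j => G.Edge (Sum.inl j) (Sum.inl i)

open Classical in
/-- The influential followers of follower `i`: those with a directed path to `i`. -/
noncomputable def inflFollowers (i : Fin n) : Finset (Fin n) :=
  Finset.univ.filter fun j => G.Reaches (Sum.inl j) (Sum.inl i)

/-- The influential leaders of follower `i`: the neighbouring leaders of `i` and of its influential
followers. -/
noncomputable def inflLeaders (i : Fin n) : Finset (Fin m) :=
  (G.inflFollowers i ∪ {i}).biUnion G.nbrLeaders

/-- The influential leaders of a follower are exactly the leaders with a directed path to it. -/
theorem mem_inflLeaders (i : Fin n) (k : Fin m) :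
    k ∈ G.inflLeaders i ↔ G.Reaches (Sum.inr k) (Sum.inl i) := by
  simp only [inflLeaders, inflFollowers, nbrLeaders, Finset.mem_biUnion, Finset.mem_union,
    Finset.mem_filter, Finset.mem_univ, true_and, Finset.mem_singleton]
  constructor
  · rintro ⟨j, hj | rfl, hk⟩
    · exact Relation.TransGen.head hk hj
    · exact Relation.TransGen.single hk
  · intro h
    rcases Relation.TransGen.head'_iff.1 h with ⟨u, hu, hr⟩
    rcases u with j | l
    · rcases Relation.reflTransGen_iff_eq_or_transGen.1 hr with h | h
      · exact ⟨j, Or.inr (Sum.inl.inj h).symm, hu⟩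
      · exact ⟨j, Or.inl h, hu⟩
    · have h0 : G.a (Sum.inr l) (Sum.inr k) = 0 := G.leader_row l _
      exact absurd h0 (ne_of_gt hu)

/-- The column stack, over the influential leaders of follower `i` in the order of their labels, of
quantities `x k` attached to the leaders. -/
def stack {V : Type*} (x : Fin m → V) (i : Fin n) : G.inflLeaders i → V := fun k => x k

/-- A family of estimates: follower `i` holds one value for each of its influential leaders. -/
abbrev Estimates (V : Type*) : Type _ := (i : Fin n) → G.inflLeaders i → V

/-- The estimates of follower `j` as used by follower `i`: for each influential leader `k` of `i`,
the estimate of `k` held by `j` if `k` influences `j`, and otherwise that held by `i` itself. -/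
noncomputable def received {V : Type*} (x : G.Estimates V) (i j : Fin n) : G.inflLeaders i → V := fun k =>
  if h : (k : Fin m) ∈ G.inflLeaders j then x j ⟨k, h⟩ else x i k

/-- The coupling term of the observer: the weighted disagreement with the neighbouring followers
plus `δ_i` times the deviation from the true leader quantities `y`, where `δ_i` is diagonal and acts
on the block of leader `k` as multiplication by the pinning gain from `k` to `i`. -/
noncomputable def coupling {V : Type*} [AddCommGroup V] [Module ℝ V]
    (x : G.Estimates V) (y : Fin m → V) (i : Fin n) : G.inflLeaders i → V :=
  ∑ j ∈ G.nbrFollowers i, G.a (Sum.inl i) (Sum.inl j) • (G.received x i j - x i)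
    + fun k : G.inflLeaders i => G.a (Sum.inl i) (Sum.inr k) • (G.stack y i k - x i k)

end CommGraph

/-- `w` is a solution of the linear leader dynamics `ẇ = S w` on `[0, ∞)`. -/
def IsLeaderTrajectory {q : ℕ} (S : Matrix (Fin q) (Fin q) ℝ) (w : ℝ → Fin q → ℝ) : Prop :=
  ∀ t, 0 ≤ t → HasDerivWithinAt w (S *ᵥ w t) (Set.Ici 0) t

/-- Marginal stability of `ẇ = S w`: every initial state excites a bounded response. -/
def MarginallyStable {q : ℕ} (S : Matrix (Fin q) (Fin q) ℝ) : Prop :=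
  ∀ w : ℝ → Fin q → ℝ, IsLeaderTrajectory S w → ∃ C : ℝ, ∀ t, 0 ≤ t → ‖w t‖ ≤ C

section

/- Matrices carry the Frobenius norm here. Only finite-dimensional spaces occur, so exponential
convergence does not depend on the choice of the norm. -/
attribute [local instance] Matrix.frobeniusNormedAddCommGroup

/-- `x t → 0` exponentially as `t → ∞`, for a column stack `x t` of vectors. -/
def ConvergesExponentially {κ ι : Type*} [Fintype κ] [Fintype ι] (x : ℝ → κ → ι → ℝ) : Prop :=
  ∃ C α : ℝ, 0 < α ∧ ∀ t, 0 ≤ t → ‖x t‖ ≤ C * Real.exp (-α * t)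

/-- `X t → 0` exponentially as `t → ∞`, for a column stack `X t` of matrices. -/
def ConvergesExponentiallyMat {κ ι ι' : Type*} [Fintype κ] [Fintype ι] [Fintype ι']
    (X : ℝ → κ → Matrix ι ι' ℝ) : Prop :=
  ∃ C α : ℝ, 0 < α ∧ ∀ t, 0 ≤ t → ‖X t‖ ≤ C * Real.exp (-α * t)

end

/-- `(η, Se, De)` is a solution on `[0, ∞)` of the adaptive distributed observer with gains
`βη`, `βS`, `βD`, where leader `k` has dynamics matrix `S k`, output matrix `D k` and state `ω t k`.
The initial values are arbitrary, and matrix-valued functions are differentiated entry by entry. In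
the equation of `η` the matrix multiplying `η t i` is block-diagonal with blocks `Se t i k`. -/
structure IsObserverTrajectory {n m q Q : ℕ} (G : CommGraph n m)
    (S : Fin m → Matrix (Fin q) (Fin q) ℝ) (D : Fin m → Matrix (Fin Q) (Fin q) ℝ)
    (ω : ℝ → Fin m → Fin q → ℝ) (βη βS βD : ℝ)
    (η : ℝ → G.Estimates (Fin q → ℝ))
    (Se : ℝ → G.Estimates (Matrix (Fin q) (Fin q) ℝ))
    (De : ℝ → G.Estimates (Matrix (Fin Q) (Fin q) ℝ)) : Prop where
  state : ∀ i t, 0 ≤ t → HasDerivWithinAt (fun s => η s i)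
    ((fun k => Se t i k *ᵥ η t i k) + βη • G.coupling (η t) (ω t) i) (Set.Ici 0) t
  dynamics : ∀ i k a b t, 0 ≤ t → HasDerivWithinAt (fun s => Se s i k a b)
    ((βS • G.coupling (Se t) S i) k a b) (Set.Ici 0) t
  output : ∀ i k a b t, 0 ≤ t → HasDerivWithinAt (fun s => De s i k a b)
    ((βD • G.coupling (De t) D i) k a b) (Set.Ici 0) t

/-! For a fixed leader `k`, the errors `e i` of the followers influenced by `k` form a closed system
`e i' = L (e i) - β (H e) i + f i`, where `H` is the Laplacian of these followers grounded at `k`, and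
`L` is the leader dynamics for the state estimates and `0` for the matrix entries. The perturbation
`f i` is zero for matrix entries; for state estimates it is the exponentially decaying error of `Se`
applied to the state estimate, hence bounded by `A exp (-γ t) (‖e i‖ + 1)` because the leader
trajectory is bounded.

No spectral theory is needed. Since every follower in the system is reached from `k`, the weights
`d i = 1 - ε ^ (l i + 1)`, with `l i` the least number of relays from `k` and small `ε`, satisfy `(H d) i > 0`
(`CommGraph.exists_weights`). Boundedness of the flow of `L` yields an equivalent seminorm
`N v = sup_{s ≥ 0} ‖exp (s L) v‖` which the flow does not increase (`exists_seminorm_exp_le`).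
Then `u = max_i N (e i) / d i` satisfies `u' ≤ -α u + c exp (-γ t) (u + 1)` in the sense of upper
right Dini derivatives (`expDecay_of_weightedDominant`), and comparison with an explicit supersolution
shows that it decays exponentially (`expDecay_of_slope_lt`). -/

open Filter Topology Set NormedSpace

/-! ### Exponential decay and a comparison principle -/

/-- A real function on `[0, ∞)` lies below a decaying exponential. -/
def ExpDecay (g : ℝ → ℝ) : Prop :=
  ∃ C α : ℝ, 0 < α ∧ ∀ t, 0 ≤ t → g t ≤ C * Real.exp (-α * t)

namespace ExpDecay

theorem mono {f g : ℝ → ℝ} (hg : ExpDecay g) (h : ∀ t, 0 ≤ t → f t ≤ g t) : ExpDecay f := by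
  obtain ⟨C, α, hα, H⟩ := hg
  exact ⟨C, α, hα, fun t ht => (h t ht).trans (H t ht)⟩

theorem zero : ExpDecay fun _ => 0 := ⟨0, 1, one_pos, fun t _ => by simp⟩

theorem add {f g : ℝ → ℝ} (hf : ExpDecay f) (hg : ExpDecay g) : ExpDecay fun t => f t + g t := by
  obtain ⟨C, α, hα, H⟩ := hf
  obtain ⟨C', α', hα', H'⟩ := hg
  refine ⟨|C| + |C'|, min α α', lt_min hα hα', fun t ht => ?_⟩
  have h1 : Real.exp (-α * t) ≤ Real.exp (-min α α' * t) :=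
    Real.exp_le_exp.2 (by nlinarith [min_le_left α α'])
  have h2 : Real.exp (-α' * t) ≤ Real.exp (-min α α' * t) :=
    Real.exp_le_exp.2 (by nlinarith [min_le_right α α'])
  calc f t + g t ≤ C * Real.exp (-α * t) + C' * Real.exp (-α' * t) := add_le_add (H t ht) (H' t ht)
    _ ≤ |C| * Real.exp (-α * t) + |C'| * Real.exp (-α' * t) := by
      gcongr <;> exact le_abs_self _
    _ ≤ |C| * Real.exp (-min α α' * t) + |C'| * Real.exp (-min α α' * t) := by gcongr
    _ = _ := by ring

theorem sum {ι : Type*} (s : Finset ι) {g : ι → ℝ → ℝ} (h : ∀ i, ExpDecay (g i)) :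
    ExpDecay fun t => ∑ i ∈ s, g i t := by
  classical
  induction s using Finset.induction_on with
  | empty => simpa using zero
  | insert i s hi ih => simpa [Finset.sum_insert hi] using (h i).add ih

end ExpDecay

/-- Comparison principle for `u' ≤ -α u + c e^{-γ t} (u + 1)`, the derivative being an upper right
Dini derivative. -/
theorem expDecay_of_slope_lt {u : ℝ → ℝ} (hu : ContinuousOn u (Ici 0)) {α c γ : ℝ} (hα : 0 < α)
    (hc : 0 ≤ c) (hγ : 0 < γ)
    (hslope : ∀ t, 0 ≤ t → ∀ r, -α * u t + c * Real.exp (-γ * t) * (u t + 1) < r →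
      ∀ᶠ z in 𝓝[>] t, slope u t z < r) : ExpDecay u := by
  -- The decay rate is below both rates, so that the forcing term is dominated by the slack `α - g`.
  set g := min α γ / 2 with hg
  have hg0 : 0 < g := by positivity
  have hgα : g < α := by have := min_le_left α γ; linarith
  have hgγ : g ≤ γ := by have := min_le_right α γ; linarith
  set M := |u 0| + c / (α - g) + 1 with hM
  have hαg : 0 < α - g := sub_pos.2 hgα
  have hM0 : 0 < M := by positivity
  set B : ℝ → ℝ := fun t => M * Real.exp (c / γ * (1 - Real.exp (-γ * t)) - g * t) with hB
  have hBd : ∀ t, HasDerivAt B (B t * (c * Real.exp (-γ * t) - g)) t := fun t => by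
    have h1 : HasDerivAt (fun t : ℝ => -γ * t) (-γ) t := by
      simpa using (hasDerivAt_id t).const_mul (-γ)
    have h2 : HasDerivAt (fun t : ℝ => g * t) g t := by
      simpa using (hasDerivAt_id t).const_mul g
    have h3 := ((((h1.exp.const_sub 1).const_mul (c / γ)).sub h2).exp).const_mul M
    refine h3.congr_deriv ?_
    simp only [hB, Pi.sub_apply]
    field_simp
  have hbound : ∀ t, 0 ≤ t → u t ≤ B t := fun T hT => by
    refine image_le_of_liminf_slope_right_lt_deriv_boundary (a := 0) (b := T)
      (f' := fun t => -α * u t + c * Real.exp (-γ * t) * (u t + 1))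
      (hu.mono Icc_subset_Ici_self) (fun t ht r hr => (hslope t ht.1 r hr).frequently)
      ?_ hBd ?_ ⟨hT, le_rfl⟩
    · have : 0 ≤ c / (α - g) := by positivity
      simp only [hB, mul_zero, Real.exp_zero, sub_self, mul_one]
      linarith [le_abs_self (u 0)]
    · intro t ht htB
      have ht0 : 0 ≤ t := ht.1
      have e1 : Real.exp (-γ * t) ≤ 1 := Real.exp_le_one_iff.2 (by nlinarith)
      have e2 : Real.exp (-γ * t) ≤ Real.exp (c / γ * (1 - Real.exp (-γ * t)) - g * t) := by
        apply Real.exp_le_exp.2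
        have : 0 ≤ c / γ * (1 - Real.exp (-γ * t)) := mul_nonneg (by positivity) (by linarith)
        nlinarith
      have e3 : c < (α - g) * M := by
        have : (α - g) * M = (α - g) * |u 0| + c + (α - g) := by rw [hM]; field_simp
        have : 0 ≤ (α - g) * |u 0| := by positivity
        linarith
      have e4 : c * Real.exp (-γ * t) < (α - g) * B t := by
        calc c * Real.exp (-γ * t) < (α - g) * M * Real.exp (-γ * t) := by gcongr
          _ ≤ (α - g) * M * Real.exp (c / γ * (1 - Real.exp (-γ * t)) - g * t) := by gcongr
          _ = _ := by simp only [hB]; ring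
      show -α * u t + c * Real.exp (-γ * t) * (u t + 1) < B t * (c * Real.exp (-γ * t) - g)
      rw [htB]
      linarith
  refine ⟨M * Real.exp (c / γ), g, hg0, fun t ht => (hbound t ht).trans ?_⟩
  rw [mul_assoc, ← Real.exp_add]
  have : 0 ≤ c / γ * Real.exp (-γ * t) := by positivity
  refine mul_le_mul_of_nonneg_left (Real.exp_le_exp.2 ?_) hM0.le
  linarith

/-! ### Cooperative couplings of bounded linear flows -/

section Linear

variable {E : Type*} [NormedAddCommGroup E] [NormedSpace ℝ E] [CompleteSpace E]

theorem hasDerivAt_exp_smul_apply (L : E →L[ℝ] E) (v : E) (t : ℝ) :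
    HasDerivAt (fun s : ℝ => exp (s • L) v) (L (exp (t • L) v)) t := by
  have h := hasDerivAt_exp_smul_const' (𝕂 := ℝ) L t
  exact ((ContinuousLinearMap.apply ℝ E v).hasFDerivAt.comp_hasDerivAt t h)

/-- If the flow of `v' = L v` is bounded on `[0, ∞)`, then `v ↦ sup_{s ≥ 0} ‖exp (s L) v‖` is an
equivalent norm that the flow does not increase. -/
theorem exists_seminorm_exp_le (L : E →L[ℝ] E)
    (hL : ∀ v, ∃ C, ∀ t : ℝ, 0 ≤ t → ‖exp (t • L) v‖ ≤ C) :
    ∃ N : Seminorm ℝ E, (∀ v, ‖v‖ ≤ N v) ∧ (∃ K, 0 ≤ K ∧ ∀ v, N v ≤ K * ‖v‖) ∧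
      ∀ h : ℝ, 0 ≤ h → ∀ v, N (exp (h • L) v) ≤ N v := by
  let p : Ici (0 : ℝ) → Seminorm ℝ E := fun s =>
    (normSeminorm ℝ E).comp (exp ((s : ℝ) • L)).toLinearMap
  have hp : ∀ s v, p s v = ‖exp ((s : ℝ) • L) v‖ := fun s v => rfl
  obtain ⟨K, hK⟩ := banach_steinhaus (g := fun s : Ici (0 : ℝ) => exp ((s : ℝ) • L))
    fun v => (hL v).imp fun C hC s => hC s s.2
  have hK' : ∀ s v, p s v ≤ K * ‖v‖ := fun s v => ContinuousLinearMap.le_of_opNorm_le _ (hK s) v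
  have hbdd : BddAbove (range p) := Seminorm.bddAbove_range_iff.2 fun v =>
    ⟨K * ‖v‖, by rintro _ ⟨s, rfl⟩; exact hK' s v⟩
  have hbdd' : ∀ v, BddAbove (range fun s => p s v) := Seminorm.bddAbove_range_iff.1 hbdd
  have hN : ∀ v, (⨆ s, p s) v = ⨆ s, p s v := fun v => Seminorm.iSup_apply hbdd
  refine ⟨⨆ s, p s, fun v => ?_, ⟨K, ?_, fun v => ?_⟩, fun h hh v => ?_⟩
  · rw [hN]
    have := le_ciSup (hbdd' v) ⟨0, self_mem_Ici⟩
    simpa [hp] using this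
  · exact (norm_nonneg _).trans (hK ⟨0, self_mem_Ici⟩)
  · rw [hN]
    exact ciSup_le fun s => hK' s v
  · rw [hN, hN]
    refine ciSup_le fun s => ?_
    refine le_trans (le_of_eq ?_) (le_ciSup (hbdd' v) ⟨s + h, add_nonneg s.2 hh⟩)
    have hcomm : Commute ((s : ℝ) • L) (h • L) := ((Commute.refl L).smul_left _).smul_right _
    let := NormedAlgebra.restrictScalars ℚ ℝ (E →L[ℝ] E)
    rw [hp, hp, add_smul, exp_add_of_commute hcomm]
    rfl

/-- One-step growth estimate for a trajectory with velocity `L y - b y + g`, in a seminorm that the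
flow of `L` does not increase. -/
theorem eventually_seminorm_le {L : E →L[ℝ] E} {N : Seminorm ℝ E} {K : ℝ}
    (hK0 : 0 ≤ K) (hK : ∀ v, N v ≤ K * ‖v‖) (hN : ∀ h : ℝ, 0 ≤ h → ∀ v, N (exp (h • L) v) ≤ N v)
    {y : ℝ → E} {g : E} {b t : ℝ}
    (hy : HasDerivWithinAt y (L (y t) - b • y t + g) (Ioi t) t) {δ : ℝ} (hδ : 0 < δ) :
    ∀ᶠ z in 𝓝[>] t, N (y z) ≤ N (y t) + (z - t) * (-b * N (y t) + N g + δ) := by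
  -- `r` is the deviation of `y` from a first-order model of it; its derivative at `t` vanishes.
  set r : ℝ → E := fun z =>
    y z - ((1 - (z - t) * b) • exp ((z - t) • L) (y t) + (z - t) • g) with hr
  have hid : HasDerivAt (fun z : ℝ => z - t) 1 t := (hasDerivAt_id t).sub_const t
  have h1 : HasDerivAt (fun z : ℝ => exp ((z - t) • L) (y t)) (L (y t)) t := by
    have h0 := hasDerivAt_exp_smul_apply L (y t) (t - t)
    simpa using h0.comp_sub_const t t
  have h2 : HasDerivAt (fun z : ℝ => 1 - (z - t) * b) (-b) t := by
    simpa using (hid.mul_const b).const_sub 1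
  have h3 : HasDerivWithinAt r 0 (Ioi t) t := by
    refine (hy.sub ((h2.smul h1).add (hid.smul_const g)).hasDerivWithinAt).congr_deriv ?_
    simp
    abel
  have hr0 : r t = 0 := by simp [hr]
  have hlittle := (hasDerivWithinAt_iff_isLittleO.1 h3).def (c := δ / (K + 1)) (by positivity)
  have hsmall : ∀ᶠ z in 𝓝[>] t, (z - t) * b < 1 := by
    have : Tendsto (fun z : ℝ => (z - t) * b) (𝓝 t) (𝓝 ((t - t) * b)) :=
      (hid.continuousAt.mul_const b)
    rw [sub_self, zero_mul] at this
    exact (this.mono_left nhdsWithin_le_nhds).eventually_lt_const one_pos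
  filter_upwards [hlittle, hsmall, self_mem_nhdsWithin] with z hz hzb hzt
  have hh : 0 < z - t := sub_pos.2 hzt
  rw [hr0, smul_zero, sub_zero, sub_zero, Real.norm_of_nonneg hh.le] at hz
  have hNr : N (r z) ≤ (z - t) * δ := by
    calc N (r z) ≤ K * ‖r z‖ := hK _
      _ ≤ (K + 1) * (δ / (K + 1) * (z - t)) := by gcongr; linarith
      _ = _ := by field_simp
  have hsplit : y z = r z + ((1 - (z - t) * b) • exp ((z - t) • L) (y t) + (z - t) • g) := by
    simp [hr]
  have hcoef : 0 ≤ 1 - (z - t) * b := by linarith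
  calc N (y z) ≤ N (r z) + (N ((1 - (z - t) * b) • exp ((z - t) • L) (y t)) + N ((z - t) • g)) := by
        conv_lhs => rw [hsplit]
        exact (map_add_le_add N _ _).trans (by gcongr; exact map_add_le_add N _ _)
    _ = N (r z) + ((1 - (z - t) * b) * N (exp ((z - t) • L) (y t)) + (z - t) * N g) := by
        rw [map_smul_eq_mul, map_smul_eq_mul, Real.norm_of_nonneg hcoef, Real.norm_of_nonneg hh.le]
    _ ≤ (z - t) * δ + ((1 - (z - t) * b) * N (y t) + (z - t) * N g) := by
        gcongr
        exact hN _ hh.le _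
    _ = _ := by ring

/-- Exponential decay for coupled copies of a system `v' = L v` with bounded flow. The coupling
`(c, b)` is cooperative and strictly dominated by its diagonal with respect to the weights `d`, and
the perturbation is affinely bounded by the state with an exponentially decaying factor. -/
theorem expDecay_of_weightedDominant {ι : Type*} [Fintype ι] (L : E →L[ℝ] E)
    (hL : ∀ v, ∃ C, ∀ t : ℝ, 0 ≤ t → ‖exp (t • L) v‖ ≤ C)
    {b : ι → ℝ} {c : ι → ι → ℝ} (hc : ∀ i j, 0 ≤ c i j) {d : ι → ℝ} (hd : ∀ i, 0 < d i)
    {α : ℝ} (hα : 0 < α) (hdom : ∀ i, ∑ j, c i j * d j + α * d i ≤ b i * d i)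
    {y f : ℝ → ι → E}
    (hy : ∀ i t, 0 ≤ t → HasDerivWithinAt (fun s => y s i)
      (L (y t i) - b i • y t i + (∑ j, c i j • y t j + f t i)) (Ici 0) t)
    {A γ : ℝ} (hA : 0 ≤ A) (hγ : 0 < γ)
    (hf : ∀ i t, 0 ≤ t → ‖f t i‖ ≤ A * Real.exp (-γ * t) * (‖y t i‖ + 1)) (i : ι) :
    ExpDecay fun t => ‖y t i‖ := by
  obtain ⟨N, hN1, ⟨K, hK0, hK⟩, hN⟩ := exists_seminorm_exp_le L hL
  lift K to NNReal using hK0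
  have hNc : Continuous N := Seminorm.continuous_of_le (q := K • normSeminorm ℝ E)
    (continuous_const.mul continuous_norm) hK
  set u : ℝ → ℝ := fun t => ‖fun i => N (y t i) / d i‖ with hu
  have hle : ∀ t i, N (y t i) ≤ u t * d i := fun t i => by
    have h := norm_le_pi_norm (fun i => N (y t i) / d i) i
    rw [Real.norm_of_nonneg (div_nonneg (apply_nonneg N _) (hd i).le)] at h
    exact (div_le_iff₀ (hd i)).1 h
  have hu0 : ∀ t, 0 ≤ u t := fun t => norm_nonneg _
  have huc : ContinuousOn u (Ici 0) := by
    refine ContinuousOn.norm (continuousOn_pi.2 fun i => ContinuousOn.div_const ?_ _)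
    exact hNc.comp_continuousOn fun t ht => (hy i t ht).continuousWithinAt
  set R : ℝ := 1 + ∑ j, (d j)⁻¹ with hR
  have hR1 : 1 ≤ R := by
    have : 0 ≤ ∑ j, (d j)⁻¹ := Finset.sum_nonneg fun j _ => (inv_pos.2 (hd j)).le
    linarith
  have hRd : ∀ i, 1 ≤ R * d i := fun i => by
    have h : (d i)⁻¹ ≤ ∑ j, (d j)⁻¹ :=
      Finset.single_le_sum (fun j _ => (inv_pos.2 (hd j)).le) (Finset.mem_univ i)
    calc (1 : ℝ) = (d i)⁻¹ * d i := (inv_mul_cancel₀ (hd i).ne').symm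
      _ ≤ R * d i := by gcongr; exacts [(hd i).le, by linarith]
  have key : ExpDecay u := by
    refine expDecay_of_slope_lt huc hα (c := K * A * R) (by positivity) hγ fun t ht r hr => ?_
    set ε := K * A * R * Real.exp (-γ * t) * (u t + 1) with hε
    set δ := (r - (-α * u t + ε)) / 2 with hδ
    have hδ0 : 0 < δ := by rw [hδ]; linarith
    have hstep : ∀ᶠ z in 𝓝[>] t, ∀ i, N (y z i) ≤ N (y t i) + (z - t) *
        (-b i * N (y t i) + N (∑ j, c i j • y t j + f t i) + δ * d i) :=
      eventually_all.2 fun i => eventually_seminorm_le K.2 hK hN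
        ((hy i t ht).mono fun s (hs : t < s) => ht.trans hs.le) (mul_pos hδ0 (hd i))
    have hsmall : ∀ᶠ z in 𝓝[>] t, ∀ i, (z - t) * b i < 1 := eventually_all.2 fun i => by
      have : Tendsto (fun z : ℝ => (z - t) * b i) (𝓝 t) (𝓝 ((t - t) * b i)) :=
        (continuous_id.sub continuous_const).continuousAt.mul_const _
      rw [sub_self, zero_mul] at this
      exact (this.mono_left nhdsWithin_le_nhds).eventually_lt_const one_pos
    filter_upwards [hstep, hsmall, self_mem_nhdsWithin] with z hz hzb hzt
    have hh : 0 < z - t := sub_pos.2 hzt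
    have hg : ∀ i, N (∑ j, c i j • y t j + f t i) ≤ (∑ j, c i j * d j) * u t + ε * d i := fun i => by
      have h1 : N (∑ j, c i j • y t j) ≤ (∑ j, c i j * d j) * u t := by
        rw [Finset.sum_mul]
        refine (Finset.le_sum_of_subadditive N (map_zero N).le (map_add_le_add N) _ _).trans
          (Finset.sum_le_sum fun j _ => ?_)
        rw [map_smul_eq_mul, Real.norm_of_nonneg (hc i j)]
        calc c i j * N (y t j) ≤ c i j * (u t * d j) :=
              mul_le_mul_of_nonneg_left (hle t j) (hc i j)
          _ = _ := by ring
      have h2 : N (f t i) ≤ ε * d i := by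
        have h3 : ‖y t i‖ + 1 ≤ R * d i * (u t + 1) := by
          have h4 := (hN1 (y t i)).trans (hle t i)
          have h5 : u t * d i ≤ R * (u t * d i) :=
            le_mul_of_one_le_left (mul_nonneg (hu0 t) (hd i).le) hR1
          linarith [hRd i]
        calc N (f t i) ≤ K * ‖f t i‖ := hK _
          _ ≤ K * (A * Real.exp (-γ * t) * (‖y t i‖ + 1)) := by gcongr; exact hf i t ht
          _ ≤ K * (A * Real.exp (-γ * t) * (R * d i * (u t + 1))) := by gcongr
          _ = _ := by rw [hε]; ring
      exact (map_add_le_add N _ _).trans (add_le_add h1 h2)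
    have hbd : ∀ i, N (y z i) ≤ (u t + (z - t) * (-α * u t + ε + δ)) * d i := fun i => by
      have h1 : 0 ≤ (1 - (z - t) * b i) * (u t * d i - N (y t i)) :=
        mul_nonneg (by linarith [hzb i]) (by linarith [hle t i])
      have h2 : 0 ≤ (z - t) * (u t * (b i * d i - (∑ j, c i j * d j + α * d i))) :=
        mul_nonneg hh.le (mul_nonneg (hu0 t) (by linarith [hdom i]))
      have h3 := mul_le_mul_of_nonneg_left (hg i) hh.le
      have h4 := hz i
      nlinarith
    have hX : u z ≤ u t + (z - t) * (-α * u t + ε + δ) := by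
      rcases isEmpty_or_nonempty ι with hι | ⟨⟨i⟩⟩
      · have hz0 : ∀ s, u s = 0 := fun s => by
          rw [hu]; simp only; rw [Subsingleton.elim (fun i => N (y s i) / d i) 0, norm_zero]
        have : 0 ≤ ε := by rw [hε, hz0]; positivity
        rw [hz0, hz0]
        nlinarith
      · refine (pi_norm_le_iff_of_nonneg ?_).2 fun j => ?_
        · exact nonneg_of_mul_nonneg_left ((apply_nonneg N _).trans (hbd i)) (hd i)
        · rw [Real.norm_of_nonneg (div_nonneg (apply_nonneg N _) (hd j).le)]
          exact (div_le_iff₀ (hd j)).2 (hbd j)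
    rw [slope_def_field, div_lt_iff₀ hh]
    have : -α * u t + ε + δ < r := by rw [hδ]; linarith
    nlinarith
  obtain ⟨C, α', hα', hC⟩ := key
  refine ⟨C * d i, α', hα', fun t ht => ?_⟩
  calc ‖y t i‖ ≤ u t * d i := (hN1 _).trans (hle t i)
    _ ≤ C * Real.exp (-α' * t) * d i := by gcongr; exacts [(hd i).le, hC t ht]
    _ = _ := by ring

end Linear

/-! ### The grounded Laplacian of the followers influenced by a leader -/

namespace CommGraph

variable {n m : ℕ} (G : CommGraph n m)

/-- The followers that leader `k` influences. -/
abbrev Influenced (k : Fin m) : Type := {i : Fin n // k ∈ G.inflLeaders i}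

/-- Leader `k` is connected to follower `i` by a walk with exactly `l` intermediate followers, not
necessarily distinct. -/
def HearsThrough (k : Fin m) : ℕ → Fin n → Prop
  | 0, i => 0 < G.a (Sum.inl i) (Sum.inr k)
  | l + 1, i => ∃ j, HearsThrough k l j ∧ 0 < G.a (Sum.inl i) (Sum.inl j)

variable {G}

theorem HearsThrough.mem_inflLeaders {k : Fin m} {l : ℕ} {i : Fin n} (h : G.HearsThrough k l i) :
    k ∈ G.inflLeaders i := by
  induction l generalizing i with
  | zero => exact (G.mem_inflLeaders i k).2 (.single h)
  | succ l ih =>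
    obtain ⟨j, hj, hij⟩ := h
    exact (G.mem_inflLeaders i k).2 (((G.mem_inflLeaders j k).1 (ih hj)).tail hij)

theorem exists_hearsThrough {k : Fin m} {v : Fin n ⊕ Fin m} (h : G.Reaches (Sum.inr k) v) :
    ∀ i, v = Sum.inl i → ∃ l, G.HearsThrough k l i := by
  induction h with
  | single h => rintro i rfl; exact ⟨0, h⟩
  | @tail u v hu huv ih =>
    rintro i rfl
    rcases u with j | l
    · obtain ⟨l, hl⟩ := ih j rfl
      exact ⟨l + 1, j, hl, huv⟩
    · obtain ⟨w, _, hw⟩ := Relation.TransGen.tail'_iff.1 hu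
      exact absurd (G.leader_row l w) (ne_of_gt hw)

variable (G)

/-- The followers influenced by leader `k` carry positive weights for which their grounded Laplacian
is strictly diagonally dominant: `d i = 1 - ε ^ (l i + 1)` with `l i` the least number of relays between
`k` and `i`, and `ε` small. -/
theorem exists_weights (k : Fin m) : ∃ d : G.Influenced k → ℝ, (∀ i, 0 < d i) ∧
    ∀ i, 0 < ∑ j : G.Influenced k, G.a (Sum.inl i.1) (Sum.inl j.1) * (d i - d j)
      + G.a (Sum.inl i.1) (Sum.inr k) * d i := by
  classical
  have hex : ∀ i : G.Influenced k, ∃ l, G.HearsThrough k l i.1 := fun i =>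
    exists_hearsThrough ((G.mem_inflLeaders i.1 k).1 i.2) _ rfl
  let l : G.Influenced k → ℕ := fun i => Nat.find (hex i)
  have hl : ∀ i, G.HearsThrough k (l i) i.1 := fun i => Nat.find_spec (hex i)
  have hlmin : ∀ i s, G.HearsThrough k s i.1 → l i ≤ s := fun i s h => Nat.find_min' (hex i) h
  let W : G.Influenced k → ℝ := fun i => ∑ j : G.Influenced k, G.a (Sum.inl i.1) (Sum.inl j.1)
  obtain ⟨ε, hε0, hε1, hε⟩ : ∃ ε : ℝ, 0 < ε ∧ ε < 1 ∧ ∀ (i : G.Influenced k) v,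
      0 < G.a (Sum.inl i.1) v → ε * W i < G.a (Sum.inl i.1) v * (1 - ε) := by
    have h1 : ∀ᶠ ε : ℝ in 𝓝[>] 0, ∀ (i : G.Influenced k) v,
        0 < G.a (Sum.inl i.1) v → ε * W i < G.a (Sum.inl i.1) v * (1 - ε) := by
      refine eventually_all.2 fun i => eventually_all.2 fun v => ?_
      by_cases hv : 0 < G.a (Sum.inl i.1) v
      · have hc1 : ContinuousAt (fun ε : ℝ => ε * W i) 0 := by fun_prop
        have hc2 : ContinuousAt (fun ε : ℝ => G.a (Sum.inl i.1) v * (1 - ε)) 0 := by fun_prop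
        have := hc1.tendsto.eventually_lt hc2.tendsto (by simpa using hv)
        filter_upwards [nhdsWithin_le_nhds this] with ε h _ using h
      · exact Eventually.of_forall fun _ h => absurd h hv
    have h2 : ∀ᶠ ε : ℝ in 𝓝[>] 0, ε ∈ Ioo (0 : ℝ) 1 := Ioo_mem_nhdsGT one_pos
    obtain ⟨ε, h, h'⟩ := (h1.and h2).exists
    exact ⟨ε, h'.1, h'.2, h⟩
  have hpow : ∀ s, ε ^ (s + 1) < 1 := fun s => pow_lt_one₀ hε0.le hε1 s.succ_ne_zero
  refine ⟨fun i => 1 - ε ^ (l i + 1), fun i => sub_pos.2 (hpow _), fun i => ?_⟩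
  have hterm : ∀ j : G.Influenced k, -(G.a (Sum.inl i.1) (Sum.inl j.1) * ε ^ (l i + 1)) ≤
      G.a (Sum.inl i.1) (Sum.inl j.1) * (1 - ε ^ (l i + 1) - (1 - ε ^ (l j + 1))) := fun j => by
    have := mul_nonneg (G.nonneg (Sum.inl i.1) (Sum.inl j.1)) (pow_pos hε0 (l j + 1)).le
    linarith
  rcases hli : l i with _ | s
  · have h0 : 0 < G.a (Sum.inl i.1) (Sum.inr k) := by have := hl i; rwa [hli] at this
    have h1 : -(ε * W i) ≤ ∑ j : G.Influenced k, G.a (Sum.inl i.1) (Sum.inl j.1) *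
        (1 - ε ^ (l i + 1) - (1 - ε ^ (l j + 1))) := by
      rw [Finset.mul_sum, ← Finset.sum_neg_distrib]
      refine Finset.sum_le_sum fun j _ => le_trans (le_of_eq ?_) (hterm j)
      rw [hli]; ring
    rw [hli] at h1
    have h2 := hε i _ h0
    beta_reduce
    rw [hli]
    simp only [zero_add, pow_one] at h1 ⊢
    linarith
  · obtain ⟨j0, hj0, ha⟩ : G.HearsThrough k (s + 1) i.1 := hli ▸ hl i
    let p : G.Influenced k := ⟨j0, hj0.mem_inflLeaders⟩
    have hp : l p ≤ s := hlmin p s hj0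
    have h1 : -(ε ^ (s + 2) * W i) + G.a (Sum.inl i.1) (Sum.inl j0) * ε ^ (s + 1) ≤
        ∑ j : G.Influenced k, G.a (Sum.inl i.1) (Sum.inl j.1) *
        (1 - ε ^ (s + 2) - (1 - ε ^ (l j + 1))) := by
      have : ∑ j : G.Influenced k, (-(ε ^ (s + 2) * G.a (Sum.inl i.1) (Sum.inl j.1)) +
          if j = p then G.a (Sum.inl i.1) (Sum.inl j0) * ε ^ (s + 1) else 0) =
          -(ε ^ (s + 2) * W i) + G.a (Sum.inl i.1) (Sum.inl j0) * ε ^ (s + 1) := by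
        simp [Finset.sum_add_distrib, W, Finset.mul_sum]
      rw [← this]
      refine Finset.sum_le_sum fun j _ => ?_
      split_ifs with hj
      · subst hj
        have : ε ^ (s + 1) ≤ ε ^ (l p + 1) :=
          pow_le_pow_of_le_one hε0.le hε1.le (by omega)
        have := mul_le_mul_of_nonneg_left this ha.le
        show -(ε ^ (s + 2) * G.a (Sum.inl i.1) (Sum.inl j0)) + _ ≤
          G.a (Sum.inl i.1) (Sum.inl j0) * _
        linarith
      · have := hterm j
        rw [hli] at this
        linarith
    have h2 := mul_lt_mul_of_pos_left (hε i _ ha) (pow_pos hε0 (s + 1))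
    have h3 : 0 ≤ G.a (Sum.inl i.1) (Sum.inr k) * (1 - ε ^ (s + 2)) :=
      mul_nonneg (G.nonneg _ _) (sub_pos.2 (hpow _)).le
    -- The pinning term is nonnegative; the edge from `j0` beats all the others.
    have h4 : ε ^ (s + 1) * (G.a (Sum.inl i.1) (Sum.inl j0) * (1 - ε)) - ε ^ (s + 1) * (ε * W i)
        ≤ -(ε ^ (s + 2) * W i) + G.a (Sum.inl i.1) (Sum.inl j0) * ε ^ (s + 1) := by
      have : 0 ≤ ε ^ (s + 1) * (G.a (Sum.inl i.1) (Sum.inl j0) * ε) := by positivity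
      have e : ε ^ (s + 2) = ε ^ (s + 1) * ε := pow_succ _ _
      rw [e]; linarith
    beta_reduce
    rw [hli]
    linarith

/-- In terms of the deviations from `y k`, the coupling of the observer is minus the grounded
Laplacian of the followers influenced by `k`. -/
theorem coupling_apply {V : Type*} [AddCommGroup V] [Module ℝ V] (x : G.Estimates V) (y : Fin m → V)
    (k : Fin m) (i : G.Influenced k) :
    G.coupling x y i.1 ⟨k, i.2⟩ =
      -((∑ j : G.Influenced k, G.a (Sum.inl i.1) (Sum.inl j.1) + G.a (Sum.inl i.1) (Sum.inr k)) •
        (x i.1 ⟨k, i.2⟩ - y k)) +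
      ∑ j : G.Influenced k, G.a (Sum.inl i.1) (Sum.inl j.1) • (x j.1 ⟨k, j.2⟩ - y k) := by
  classical
  have h1 : (∑ j ∈ G.nbrFollowers i.1,
      G.a (Sum.inl i.1) (Sum.inl j) • (G.received x i.1 j - x i.1)) ⟨k, i.2⟩ =
      ∑ j : G.Influenced k, G.a (Sum.inl i.1) (Sum.inl j.1) •
        (x j.1 ⟨k, j.2⟩ - x i.1 ⟨k, i.2⟩) := by
    rw [Finset.sum_apply, nbrFollowers, Finset.sum_filter]
    have h2 : ∀ j, (if G.Edge (Sum.inl j) (Sum.inl i.1) then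
        (G.a (Sum.inl i.1) (Sum.inl j) • (G.received x i.1 j - x i.1)) ⟨k, i.2⟩ else 0) =
        if h : k ∈ G.inflLeaders j then
          G.a (Sum.inl i.1) (Sum.inl j) • (x j ⟨k, h⟩ - x i.1 ⟨k, i.2⟩) else 0 := fun j => by
      by_cases hE : G.Edge (Sum.inl j) (Sum.inl i.1)
      · rw [if_pos hE]
        by_cases hk : k ∈ G.inflLeaders j <;> simp [received, hk]
      · have h0 : G.a (Sum.inl i.1) (Sum.inl j) = 0 := le_antisymm (not_lt.1 hE) (G.nonneg _ _)
        simp [hE, h0]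
    rw [Finset.sum_congr rfl fun j _ => h2 j]
    exact (Fintype.sum_of_injective _ Subtype.val_injective _ _
      (fun j hj => dif_neg fun h => hj ⟨⟨j, h⟩, rfl⟩) fun j => by rw [dif_pos j.2]).symm
  rw [coupling, Pi.add_apply, h1]
  simp only [stack, add_smul, Finset.sum_smul, smul_sub, Finset.sum_sub_distrib]
  abel

variable {G}

/-! ### Decay of the observer errors -/

/-- Exponential decay of the errors `e` about one leader, when they follow the leader dynamics,
observer coupling with positive gain and an affinely bounded, exponentially vanishing perturbation. -/
theorem expDecay_error {E : Type*} [NormedAddCommGroup E] [NormedSpace ℝ E] [CompleteSpace E]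
    {k : Fin m} (L : E →L[ℝ] E) (hL : ∀ v, ∃ C, ∀ t : ℝ, 0 ≤ t → ‖exp (t • L) v‖ ≤ C)
    {β : ℝ} (hβ : 0 < β) {e f : ℝ → G.Influenced k → E}
    (he : ∀ i t, 0 ≤ t → HasDerivWithinAt (fun s => e s i)
      (L (e t i) + β • (-((∑ j : G.Influenced k, G.a (Sum.inl i.1) (Sum.inl j.1)
          + G.a (Sum.inl i.1) (Sum.inr k)) • e t i) +
        ∑ j : G.Influenced k, G.a (Sum.inl i.1) (Sum.inl j.1) • e t j) + f t i) (Ici 0) t)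
    {A γ : ℝ} (hA : 0 ≤ A) (hγ : 0 < γ)
    (hf : ∀ i t, 0 ≤ t → ‖f t i‖ ≤ A * Real.exp (-γ * t) * (‖e t i‖ + 1)) (i : G.Influenced k) :
    ExpDecay fun t => ‖e t i‖ := by
  obtain ⟨d, hd, hdd⟩ := G.exists_weights k
  obtain ⟨α, hα0, hα⟩ : ∃ α : ℝ, 0 < α ∧ ∀ i, α * d i <
      β * (∑ j : G.Influenced k, G.a (Sum.inl i.1) (Sum.inl j.1) * (d i - d j)
        + G.a (Sum.inl i.1) (Sum.inr k) * d i) := by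
    have h1 : ∀ᶠ α : ℝ in 𝓝[>] 0, ∀ i, α * d i <
      β * (∑ j : G.Influenced k, G.a (Sum.inl i.1) (Sum.inl j.1) * (d i - d j)
        + G.a (Sum.inl i.1) (Sum.inr k) * d i) := eventually_all.2 fun i => by
      have hc : ContinuousAt (fun α : ℝ => α * d i) 0 := by fun_prop
      refine nhdsWithin_le_nhds (hc.tendsto.eventually_lt_const ?_)
      rw [zero_mul]
      exact mul_pos hβ (hdd i)
    obtain ⟨α, h, h'⟩ := (h1.and self_mem_nhdsWithin).exists
    exact ⟨α, h', h⟩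
  refine expDecay_of_weightedDominant L hL
    (b := fun i => β * (∑ j : G.Influenced k, G.a (Sum.inl i.1) (Sum.inl j.1)
          + G.a (Sum.inl i.1) (Sum.inr k)))
    (c := fun i j => β * G.a (Sum.inl i.1) (Sum.inl j.1)) (fun i j => mul_nonneg hβ.le (G.nonneg _ _))
    hd hα0 (fun i => ?_) (fun i t ht => (he i t ht).congr_deriv ?_) hA hγ hf i
  · have h := (hα i).le
    simp only [mul_sub, Finset.sum_sub_distrib, ← Finset.sum_mul] at h
    simp only [mul_assoc, ← Finset.mul_sum]
    nlinarith
  · simp only [smul_add, smul_neg, smul_smul, Finset.smul_sum]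
    abel

/-- The observer of a constant scalar quantity converges exponentially. -/
theorem expDecay_scalar {k : Fin m} {β : ℝ} (hβ : 0 < β) {e : ℝ → G.Influenced k → ℝ}
    (he : ∀ i t, 0 ≤ t → HasDerivWithinAt (fun s => e s i)
      (β * (-((∑ j : G.Influenced k, G.a (Sum.inl i.1) (Sum.inl j.1)
          + G.a (Sum.inl i.1) (Sum.inr k)) * e t i) +
        ∑ j : G.Influenced k, G.a (Sum.inl i.1) (Sum.inl j.1) * e t j)) (Ici 0) t)
    (i : G.Influenced k) : ExpDecay fun t => ‖e t i‖ := by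
  refine expDecay_error (0 : ℝ →L[ℝ] ℝ) (fun v => ⟨‖v‖, fun t _ => by simp [exp_zero]⟩) hβ
    (f := fun _ _ => 0) (fun i t ht => ?_) le_rfl one_pos (fun i t _ => by simp) i
  simpa using he i t ht

/-- A matrix observer with constant reference `Y` converges exponentially, entry by entry. -/
theorem expDecay_entry {ι ι' : Type*} {Y : Fin m → Matrix ι ι' ℝ} {β : ℝ} (hβ : 0 < β)
    {X : ℝ → G.Estimates (Matrix ι ι' ℝ)}
    (hX : ∀ i k a b t, 0 ≤ t → HasDerivWithinAt (fun s => X s i k a b)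
      ((β • G.coupling (X t) Y i) k a b) (Ici 0) t)
    (i : Fin n) (k : G.inflLeaders i) (a : ι) (b : ι') :
    ExpDecay fun t => |X t i k a b - Y k a b| := by
  refine expDecay_scalar (k := k.1) hβ (e := fun t j => X t j.1 ⟨k, j.2⟩ a b - Y k a b)
    (fun j t ht => ?_) ⟨i, k.2⟩
  refine ((hX j.1 ⟨k, j.2⟩ a b t ht).sub_const _).congr_deriv ?_
  rw [Pi.smul_apply, coupling_apply]
  simp [Matrix.sum_apply]

end CommGraph

/-! ### Norms of stacks and matrices -/

section

attribute [local instance] Matrix.frobeniusNormedAddCommGroup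

theorem frobenius_norm_le_sum {ι ι' : Type*} [Fintype ι] [Fintype ι'] (M : Matrix ι ι' ℝ) :
    ‖M‖ ≤ ∑ a, ∑ b, |M a b| := by
  have h0 : 0 ≤ ∑ a, ∑ b, |M a b| := by positivity
  rw [Matrix.frobenius_norm_def, ← Real.sqrt_eq_rpow, Real.sqrt_le_left h0]
  simp only [Real.rpow_two, Real.norm_eq_abs]
  calc ∑ a, ∑ b, |M a b| ^ 2 ≤ ∑ a, (∑ b, |M a b|) ^ 2 :=
        Finset.sum_le_sum fun a _ => Finset.sum_sq_le_sq_sum_of_nonneg fun b _ => abs_nonneg _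
    _ ≤ _ := Finset.sum_sq_le_sq_sum_of_nonneg fun a _ => by positivity

theorem convergesExponentiallyMat_of_entries {κ ι ι' : Type*} [Fintype κ] [Fintype ι] [Fintype ι']
    {X : ℝ → κ → Matrix ι ι' ℝ} (h : ∀ k a b, ExpDecay fun t => |X t k a b|) :
    ConvergesExponentiallyMat X := by
  refine (ExpDecay.sum Finset.univ fun k => ExpDecay.sum Finset.univ fun a =>
    ExpDecay.sum Finset.univ fun b => h k a b).mono fun t _ => ?_
  refine (pi_norm_le_iff_of_nonneg (by positivity)).2 fun k => (frobenius_norm_le_sum _).trans ?_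
  exact Finset.single_le_sum (f := fun k => ∑ a, ∑ b, |X t k a b|) (fun k _ => by positivity)
    (Finset.mem_univ k)

end

theorem convergesExponentially_of_blocks {κ ι : Type*} [Fintype κ] [Fintype ι]
    {x : ℝ → κ → ι → ℝ} (h : ∀ k, ExpDecay fun t => ‖x t k‖) : ConvergesExponentially x := by
  refine (ExpDecay.sum Finset.univ h).mono fun t _ => ?_
  refine (pi_norm_le_iff_of_nonneg (by positivity)).2 fun k => ?_
  exact Finset.single_le_sum (f := fun k => ‖x t k‖) (fun k _ => norm_nonneg _) (Finset.mem_univ k)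

theorem norm_mulVec_le_sum {ι ι' : Type*} [Fintype ι] [Fintype ι'] (M : Matrix ι ι' ℝ) (v : ι' → ℝ) :
    ‖M *ᵥ v‖ ≤ (∑ a, ∑ b, |M a b|) * ‖v‖ := by
  refine (pi_norm_le_iff_of_nonneg (by positivity)).2 fun a => ?_
  calc ‖∑ b, M a b * v b‖ ≤ ∑ b, |M a b| * ‖v‖ := by
        refine norm_sum_le_of_le _ fun b _ => ?_
        rw [norm_mul, Real.norm_eq_abs]
        gcongr
        exact norm_le_pi_norm v b
    _ = (∑ b, |M a b|) * ‖v‖ := by rw [Finset.sum_mul]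
    _ ≤ _ := by
      gcongr
      exact Finset.single_le_sum (f := fun a => ∑ b, |M a b|) (fun a _ => by positivity)
        (Finset.mem_univ a)

/-! ### The state estimates -/

/-- A trajectory `t ↦ exp (t L) v` of a marginally stable leader is bounded. -/
theorem MarginallyStable.exp_bounded {q : ℕ} {S : Matrix (Fin q) (Fin q) ℝ}
    (hS : MarginallyStable S) (v : Fin q → ℝ) :
    ∃ C, ∀ t : ℝ, 0 ≤ t →
      ‖exp (t • LinearMap.toContinuousLinearMap (Matrix.toLin' S)) v‖ ≤ C :=
  hS _ fun t _ => (hasDerivAt_exp_smul_apply _ v t).hasDerivWithinAt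

/-- The error of the state estimates obeys the leader dynamics, coupled through the observer and
perturbed by the error of `Se` times the state estimate. -/
theorem expDecay_state {n m q : ℕ} {G : CommGraph n m} {S : Fin m → Matrix (Fin q) (Fin q) ℝ}
    {ω : ℝ → Fin m → Fin q → ℝ} (hω : ∀ k, IsLeaderTrajectory (S k) (fun t => ω t k)) {β : ℝ}
    {η : ℝ → G.Estimates (Fin q → ℝ)} {Se : ℝ → G.Estimates (Matrix (Fin q) (Fin q) ℝ)}
    (hη : ∀ i t, 0 ≤ t → HasDerivWithinAt (fun s => η s i)
      ((fun k => Se t i k *ᵥ η t i k) + β • G.coupling (η t) (ω t) i) (Set.Ici 0) t)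
    (hSe : ∀ i (k : G.inflLeaders i) a b, ExpDecay fun t => |Se t i k a b - S k a b|)
    (hS : ∀ k, MarginallyStable (S k)) (hβ : 0 < β) (i : Fin n) (k : G.inflLeaders i) :
    ExpDecay fun t => ‖η t i k - ω t k‖ := by
  obtain ⟨k, hk⟩ := k
  obtain ⟨W, hW⟩ := hS k _ (hω k)
  have hW0 : 0 ≤ W := (norm_nonneg _).trans (hW 0 le_rfl)
  have hsum : ExpDecay fun t => ∑ j : G.Influenced k, ∑ a, ∑ b,
      |(Se t j.1 ⟨k, j.2⟩ - S k) a b| :=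
    ExpDecay.sum _ fun j => ExpDecay.sum _ fun a => ExpDecay.sum _ fun b => hSe j.1 ⟨k, j.2⟩ a b
  obtain ⟨C, γ, hγ, hC⟩ := hsum
  have hC0 : 0 ≤ C := by
    have h := hC 0 le_rfl
    rw [mul_zero, Real.exp_zero, mul_one] at h
    exact le_trans (by positivity) h
  refine CommGraph.expDecay_error (k := k) (LinearMap.toContinuousLinearMap (Matrix.toLin' (S k)))
    (hS k).exp_bounded hβ (e := fun t j => η t j.1 ⟨k, j.2⟩ - ω t k)
    (f := fun t j => (Se t j.1 ⟨k, j.2⟩ - S k) *ᵥ η t j.1 ⟨k, j.2⟩)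
    (fun j t ht => ?_) (A := C * (1 + W)) (by positivity) hγ (fun j t ht => ?_) ⟨i, hk⟩
  · have h1 := hasDerivWithinAt_pi.1 (hη j.1 t ht) ⟨k, j.2⟩
    refine (h1.sub (hω k t ht)).congr_deriv ?_
    rw [Pi.add_apply, Pi.smul_apply, G.coupling_apply]
    simp only [LinearMap.coe_toContinuousLinearMap', Matrix.toLin'_apply, Matrix.mulVec_sub,
      Matrix.sub_mulVec]
    abel
  · have h1 : ∑ a, ∑ b, |(Se t j.1 ⟨k, j.2⟩ - S k) a b| ≤ C * Real.exp (-γ * t) :=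
      (Finset.single_le_sum (f := fun j : G.Influenced k => ∑ a, ∑ b,
        |(Se t j.1 ⟨k, j.2⟩ - S k) a b|) (fun j _ => by positivity) (Finset.mem_univ j)).trans
        (hC t ht)
    have h2 : ‖η t j.1 ⟨k, j.2⟩‖ ≤ (1 + W) * (‖η t j.1 ⟨k, j.2⟩ - ω t k‖ + 1) := by
      have h3 : ‖η t j.1 ⟨k, j.2⟩‖ ≤ ‖η t j.1 ⟨k, j.2⟩ - ω t k‖ + ‖ω t k‖ := norm_le_norm_sub_add _ _
      have h4 : 0 ≤ W * ‖η t j.1 ⟨k, j.2⟩ - ω t k‖ := by positivity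
      linarith [hW t ht]
    calc _ ≤ (∑ a, ∑ b, |(Se t j.1 ⟨k, j.2⟩ - S k) a b|) * ‖η t j.1 ⟨k, j.2⟩‖ :=
          norm_mulVec_le_sum _ _
      _ ≤ C * Real.exp (-γ * t) * ((1 + W) * (‖η t j.1 ⟨k, j.2⟩ - ω t k‖ + 1)) := by gcongr
      _ = _ := by ring

theorem theorem2 {n m q Q : ℕ} (G : CommGraph n m)
    (S : Fin m → Matrix (Fin q) (Fin q) ℝ) (D : Fin m → Matrix (Fin Q) (Fin q) ℝ)
    (ω : ℝ → Fin m → Fin q → ℝ) (hω : ∀ k, IsLeaderTrajectory (S k) (fun t => ω t k))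
    (βη βS βD : ℝ)
    (η : ℝ → G.Estimates (Fin q → ℝ))
    (Se : ℝ → G.Estimates (Matrix (Fin q) (Fin q) ℝ))
    (De : ℝ → G.Estimates (Matrix (Fin Q) (Fin q) ℝ))
    (hobs : IsObserverTrajectory G S D ω βη βS βD η Se De) :
    (0 < βS → ∀ i, ConvergesExponentiallyMat (fun t => Se t i - G.stack S i)) ∧
    (0 < βD → ∀ i, ConvergesExponentiallyMat (fun t => De t i - G.stack D i)) ∧
    ((∀ k, MarginallyStable (S k)) → 0 < βη → 0 < βS →
      ∀ i, ConvergesExponentially (fun t => η t i - G.stack (ω t) i)) := by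
  refine ⟨fun hβ i => ?_, fun hβ i => ?_, fun hS hβη hβS i => ?_⟩
  · exact convergesExponentiallyMat_of_entries fun k a b =>
      CommGraph.expDecay_entry hβ hobs.dynamics i k a b
  · exact convergesExponentiallyMat_of_entries fun k a b =>
      CommGraph.expDecay_entry hβ hobs.output i k a b
  · exact convergesExponentially_of_blocks fun k =>
      expDecay_state hω hobs.state (CommGraph.expDecay_entry hβS hobs.dynamics) hS hβη i k
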